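/- Let $R$ be a commutative Noetherian ring with unit and let $C$ be a (coassociative, counital) $R$-coalgebra with comultiplication $\Delta$ and counit $\varepsilon$, whose underlying $R$-module is locally projective: for every finitely generated submodule $F\subseteq C$, every $R$-linear map $f\colon C\to N$ and every surjective $R$-linear map $g\colon L\to N$ there is an $R$-linear map $h\colon C\to L$ with $g(h(x))=f(x)$ for all $x\in F$. Suppose that $C=\bigcup_{\alpha} C_\alpha$ for a family of subcoalgebras $C_\alpha$ (submodules carrying a coalgebra structure for which the inclusion into $C$ is a coalgebra map) which are finitely generated projective $R$-modules. Let $A=C^*=\mathrm{Hom}_R(C,R)$ be the dual algebra, with product $\langle a*b,c\rangle=\sum\langle a,c^{(1)}\rangle\langle b,c^{(2)}\rangle$, where $\Delta(c)=\sum c^{(1)}\otimes c^{(2)}$, and unit $\varepsilon$, and with the linear topology in which the kernels $A_\alpha$ of the restriction maps $A\to C_\alpha^*$, together with their finite intersections, form a basis of neighbourhoods of $0$. A left $A$-module $M$ is called discrete if the action map $A\times M\to M$ is continuous when $M$ is given the discrete topology; let $\mathrm{Disc}_A$ be the full subcategory of the category of left $A$-modules whose objects are the discrete modules. Let $i$ be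 the functor from the category $\mathrm{Comod}_C$ of right $C$-comodules to the category of left $A$-modules which sends a comodule $M$ with coaction $\rho_M\colon M\to M\otimes_R C$ to the abelian group $M$ with the action $ax=\sum_j\langle a,c_j\rangle x_j$, where $\rho_M(x)=\sum_j x_j\otimes c_j$, and which is the identity on underlying maps. Then $i(M)$ is a discrete $A$-module for every right $C$-comodule $M$, and $i$ is an isomorphism of categories $$\mathrm{Comod}_C\xrightarrow{\ \cong\ }\mathrm{Disc}_A,$$ that is, there is a functor $G\colon \mathrm{Disc}_A\to\mathrm{Comod}_C$ such that $G\circ i$ and $i\circ G$ are equal to the identity functors. -/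

import Mathlib

open CategoryTheory TensorProduct

universe u v w

/-- A module `M` is *locally projective* if for every finitely generated submodule `F ⊆ M`, every
linear map `f : M → N` and every surjective linear map `g : L → N`, there is a linear map
`h : M → L` with `g ∘ h = f` on `F`. -/
def IsLocallyProjective (R : Type u) [CommRing R] (M : Type v) [AddCommGroup M] [Module R M] :
    Prop :=
  ∀ (F : Submodule R M), F.FG →
    ∀ (L N : Type (max u v)) [AddCommGroup L] [Module R L] [AddCommGroup N] [Module R N]
      (f : M →ₗ[R] N) (g : L →ₗ[R] N), Function.Surjective g →
      ∃ h : M →ₗ[R] L, ∀ x ∈ F, g (h x) = f x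

/-- A submodule `D` of a coalgebra `C` is a *subcoalgebra* if it carries a coalgebra structure for
which the inclusion `D → C` is a morphism of coalgebras. -/
def IsSubcoalgebra {R : Type u} [CommRing R] {C : Type v} [AddCommGroup C] [Module R C]
    [Coalgebra R C] (D : Submodule R C) : Prop :=
  ∃ (_ : Coalgebra R D) (j : D →ₗc[R] C), ∀ x : D, j x = (x : C)

/-- The dual algebra `C^*` of a coalgebra `C`: the `R`-linear dual with the convolution product
`(a * b)(c) = ∑ a(c₁) b(c₂)` and unit the counit of `C`. -/
abbrev DualAlgebra (R : Type u) [CommRing R] (C : Type v) [AddCommGroup C] [Module R C] :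
    Type (max u v) :=
  WithConv (C →ₗ[R] R)

/-- The topology on `C^*` defined by a family of submodules `D α ⊆ C`: the coarsest one for which
all restriction maps `C^* → (D α)^*` are continuous, each `(D α)^*` being discrete. Their kernels
`A_α = {a | a = 0 on D α}`, and finite intersections of these, form a basis of neighbourhoods
of zero. -/
abbrev dualTopology {R : Type u} [CommRing R] {C : Type v} [AddCommGroup C] [Module R C]
    {ι : Type*} (D : ι → Submodule R C) : TopologicalSpace (DualAlgebra R C) :=
  ⨅ α, TopologicalSpace.induced
    (fun a : DualAlgebra R C => (a.ofConv.domRestrict (D α) : D α →ₗ[R] R)) ⊥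

/-- For a ring `A` with a topology `t`, the property of an `A`-module `M` of being *discrete*:
the action map `A × M → M` is continuous, `M` having the discrete topology. -/
def IsDiscreteModule {A : Type u} [Ring A] (t : TopologicalSpace A) :
    ObjectProperty (ModuleCat.{w} A) := fun M =>
  letI : TopologicalSpace A := t
  letI : TopologicalSpace M := ⊥
  Continuous fun p : A × M => p.1 • p.2

/-- The category of discrete `A`-modules, as a full subcategory of the category of left
`A`-modules. -/
abbrev DiscModuleCat (A : Type u) [Ring A] (t : TopologicalSpace A) :=
  (IsDiscreteModule.{u, w} t).FullSubcategory

/-- Right comodules over the `R`-coalgebra `C`: an `R`-module `M` with a coassociative and counital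
coaction `ρ : M → M ⊗ C`. -/
structure RightComodCat (R : Type u) [CommRing R] (C : Type v) [AddCommGroup C] [Module R C]
    [Coalgebra R C] where
  carrier : Type w
  [addCommGroup : AddCommGroup carrier]
  [module : Module R carrier]
  coact : carrier →ₗ[R] carrier ⊗[R] C
  coassoc : (TensorProduct.assoc R carrier C C).toLinearMap ∘ₗ coact.rTensor C ∘ₗ coact =
    (Coalgebra.comul : C →ₗ[R] C ⊗[R] C).lTensor carrier ∘ₗ coact
  counit : (TensorProduct.rid R carrier).toLinearMap ∘ₗ
    (Coalgebra.counit : C →ₗ[R] R).lTensor carrier ∘ₗ coact = LinearMap.id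

namespace RightComodCat

variable {R : Type u} [CommRing R] {C : Type v} [AddCommGroup C] [Module R C] [Coalgebra R C]

attribute [instance] RightComodCat.addCommGroup RightComodCat.module

/-- Morphisms of comodules: linear maps `f` with `ρ_N ∘ f = (f ⊗ 1) ∘ ρ_M`. -/
@[ext]
structure Hom (M N : RightComodCat.{u, v, w} R C) where
  toLinearMap : M.carrier →ₗ[R] N.carrier
  comm : N.coact ∘ₗ toLinearMap = toLinearMap.rTensor C ∘ₗ M.coact

instance : Category (RightComodCat.{u, v, w} R C) where
  Hom M N := Hom M N
  id M := ⟨LinearMap.id, by ext x; simp⟩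
  comp f g := ⟨g.toLinearMap ∘ₗ f.toLinearMap, by
    rw [← LinearMap.comp_assoc, g.comm, LinearMap.comp_assoc, f.comm, ← LinearMap.comp_assoc,
      ← LinearMap.rTensor_comp]⟩

/-- The action `a x = ∑ ⟨a, c_i⟩ x_i`, where `ρ(x) = ∑ x_i ⊗ c_i`. -/
def act (M : RightComodCat.{u, v, w} R C) (a : DualAlgebra R C) : M.carrier →ₗ[R] M.carrier :=
  (TensorProduct.rid R M.carrier).toLinearMap ∘ₗ a.ofConv.lTensor M.carrier ∘ₗ M.coact

theorem act_mul (M : RightComodCat.{u, v, w} R C) (a b : DualAlgebra R C) (x : M.carrier) :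
    M.act (a * b) x = M.act a (M.act b x) := by
  let φ : M.carrier ⊗[R] (C ⊗[R] C) →ₗ[R] M.carrier :=
    (TensorProduct.rid R M.carrier).toLinearMap ∘ₗ
      (LinearMap.mul' R R ∘ₗ TensorProduct.map a.ofConv b.ofConv).lTensor M.carrier
  have h₁ : M.act a ∘ₗ (TensorProduct.rid R M.carrier).toLinearMap ∘ₗ
      b.ofConv.lTensor M.carrier =
      φ ∘ₗ (TensorProduct.assoc R M.carrier C C).toLinearMap ∘ₗ M.coact.rTensor C := by
    ext m c
    have h₂ : ∀ t : M.carrier ⊗[R] C,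
        b.ofConv c • (TensorProduct.rid R M.carrier) (a.ofConv.lTensor M.carrier t) =
          φ (TensorProduct.assoc R M.carrier C C (t ⊗ₜ[R] c)) := by
      intro t
      induction t with
      | zero => simp
      | add t₁ t₂ h₁ h₂ => simp only [map_add, smul_add, TensorProduct.add_tmul, h₁, h₂]
      | tmul m' c' => simp [φ, smul_smul, mul_comm]
    simpa [act] using h₂ (M.coact m)
  have h₃ := LinearMap.congr_fun h₁ (M.coact x)
  have h₄ := LinearMap.congr_fun M.coassoc x
  simp only [LinearMap.comp_apply] at h₃ h₄
  rw [h₄] at h₃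
  refine Eq.trans ?_ h₃.symm
  change _ = (TensorProduct.rid R M.carrier) (LinearMap.lTensor _ _ (LinearMap.lTensor _ _ _))
  rw [← LinearMap.lTensor_comp_apply]
  rfl

/-- The left `C^*`-module structure of a right `C`-comodule. -/
abbrev dualModule (M : RightComodCat.{u, v, w} R C) : Module (DualAlgebra R C) M.carrier where
  smul a x := M.act a x
  one_smul x := LinearMap.congr_fun M.counit x
  mul_smul a b x := M.act_mul a b x
  smul_zero a := map_zero (M.act a)
  smul_add a := map_add (M.act a)
  add_smul a b x := by
    change M.act (a + b) x = M.act a x + M.act b x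
    simp [act, LinearMap.lTensor_add]
  zero_smul x := by
    change M.act 0 x = 0
    simp [act]

theorem act_hom {M N : RightComodCat.{u, v, w} R C} (f : M ⟶ N) (a : DualAlgebra R C)
    (x : M.carrier) : f.toLinearMap (M.act a x) = N.act a (f.toLinearMap x) := by
  have h₁ := LinearMap.congr_fun f.comm x
  simp only [LinearMap.comp_apply] at h₁
  have h₂ : ∀ t : M.carrier ⊗[R] C,
      f.toLinearMap (TensorProduct.rid R M.carrier (a.ofConv.lTensor M.carrier t)) =
        TensorProduct.rid R N.carrier
          (a.ofConv.lTensor N.carrier (f.toLinearMap.rTensor C t)) := by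
    intro t
    induction t with
    | zero => simp
    | add t₁ t₂ h₁ h₂ => simp only [map_add, h₁, h₂]
    | tmul m c => simp
  simp only [act, LinearMap.comp_apply, LinearEquiv.coe_coe, h₁]
  exact h₂ _

variable (R C) in
/-- The functor `i` from right `C`-comodules to left `C^*`-modules; it is the identity on
underlying abelian groups and on underlying maps. -/
noncomputable def toDualModule : RightComodCat.{u, v, w} R C ⥤ ModuleCat.{w} (DualAlgebra R C) where
  obj M := @ModuleCat.of (DualAlgebra R C) _ M.carrier _ M.dualModule
  map {M N} f :=
    letI := M.dualModule
    letI := N.dualModule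
    ModuleCat.ofHom
      { toFun := f.toLinearMap
        map_add' := map_add f.toLinearMap
        map_smul' := fun a x => act_hom f a x }
  map_id _ := rfl
  map_comp _ _ := rfl

end RightComodCat

/-! Local projectivity supplies finite dual bases on finitely generated submodules of `C`, so an
element of `M ⊗ C` is determined by its contractions with linear forms on `C`. A coaction is
therefore recovered from the action of `C^*`, because `a x` is the contraction of `ρ(x)` with `a`.

An element `x` of a comodule is killed by every `a` vanishing on the finitely many `C`-components of
`ρ(x)`, and these lie in finitely many `D α`; this is discreteness. Conversely, in a discrete module
`x` is killed by every `a` vanishing on some finitely generated `F`, a finite sum of `D α`. A dual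
basis `(c, φ c)` on `F` gives `a x = ∑ a(c) (φ c) x`, so `∑ (φ c) x ⊗ c` is the only possible value
of `ρ(x)`. Uniqueness also forces linearity and the comodule axioms. Both constructions keep
underlying sets and maps, whence equality of functors. -/

/-! ### Dual bases and contractions -/

section LocallyProjective

variable {R : Type u} [CommRing R] {C : Type v} [AddCommGroup C] [Module R C]

/-- Finitely generated submodules of a locally projective module have finite dual bases. -/
theorem IsLocallyProjective.exists_dual_basis (hC : IsLocallyProjective R C)
    (F : Submodule R C) (hF : F.FG) :
    ∃ (s : Finset C) (φ : C → C →ₗ[R] R), ∀ x ∈ F, ∑ c ∈ s, φ c x • c = x := by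
  classical
  -- Lift the identity of `C` through the free module on the set `C`; `ULift` only adjusts the
  -- universe.
  obtain ⟨h, hh⟩ := hC F hF (C →₀ R) (ULift.{max u v} C)
    (ULift.moduleEquiv (R := R) (M := C)).symm.toLinearMap
    ((ULift.moduleEquiv (R := R) (M := C)).symm.toLinearMap ∘ₗ
      Finsupp.linearCombination R (id : C → C))
    (fun y => ⟨Finsupp.single y.down 1, by simp⟩)
  obtain ⟨T, rfl⟩ := hF
  refine ⟨T.biUnion fun x => (h x).support, fun c => Finsupp.lapply c ∘ₗ h, fun x hx => ?_⟩
  have h₁ : Finsupp.linearCombination R (id : C → C) (h x) = x :=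
    ULift.up_injective (hh x hx)
  have h₂ : ∀ x ∈ Submodule.span R (T : Set C),
      h x ∈ Finsupp.supported R R (T.biUnion fun x => (h x).support : Set C) := by
    intro x hx
    induction hx using Submodule.span_induction with
    | mem x hx =>
      rw [Finsupp.mem_supported]
      exact_mod_cast Finset.subset_biUnion_of_mem (fun x => (h x).support) hx
    | zero => simp
    | add x y _ _ hx hy => rw [map_add]; exact Submodule.add_mem _ hx hy
    | smul r x _ hx => rw [map_smul]; exact Submodule.smul_mem _ r hx
  conv_rhs => rw [← h₁, Finsupp.linearCombination_apply,
    Finsupp.sum_of_support_subset (h x) (s := T.biUnion fun x => (h x).support)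
      (by exact_mod_cast h₂ x hx) _ (by simp)]
  rfl

variable (M : Type w) [AddCommGroup M] [Module R M]

/-- The contraction `m ⊗ c ↦ a(c) m` with a linear form `a` on `C`. -/
noncomputable def contract (a : C →ₗ[R] R) : M ⊗[R] C →ₗ[R] M :=
  (TensorProduct.rid R M).toLinearMap ∘ₗ a.lTensor M

variable {M}

@[simp]
theorem contract_tmul (a : C →ₗ[R] R) (m : M) (c : C) : contract M a (m ⊗ₜ[R] c) = a c • m := by
  simp [contract]

theorem contract_rTensor {N : Type*} [AddCommGroup N] [Module R N] (f : M →ₗ[R] N)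
    (a : C →ₗ[R] R) (t : M ⊗[R] C) :
    contract N a (f.rTensor C t) = f (contract M a t) := by
  induction t with
  | zero => simp
  | add t₁ t₂ h₁ h₂ => simp only [map_add, h₁, h₂]
  | tmul m c => simp

/-- `F` is spanned by the `C`-components of an expression for `t`. It is chosen before the dual
basis, so that one basis can serve both summands in the additive step. -/
theorem exists_fg_eq_sum_contract (t : M ⊗[R] C) :
    ∃ F : Submodule R C, F.FG ∧ ∀ (s : Finset C) (φ : C → C →ₗ[R] R),
      (∀ x ∈ F, ∑ c ∈ s, φ c x • c = x) → t = ∑ c ∈ s, contract M (φ c) t ⊗ₜ[R] c := by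
  induction t with
  | zero => exact ⟨⊥, Submodule.fg_bot, by simp⟩
  | add t₁ t₂ h₁ h₂ =>
    obtain ⟨F₁, hF₁, h₁⟩ := h₁
    obtain ⟨F₂, hF₂, h₂⟩ := h₂
    refine ⟨F₁ ⊔ F₂, hF₁.sup hF₂, fun s φ h => ?_⟩
    simp only [map_add, TensorProduct.add_tmul, Finset.sum_add_distrib]
    rw [← h₁ s φ fun x hx => h x (Submodule.mem_sup_left hx),
      ← h₂ s φ fun x hx => h x (Submodule.mem_sup_right hx)]
  | tmul m c =>
    refine ⟨R ∙ c, Submodule.fg_span_singleton c, fun s φ h => ?_⟩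
    conv_lhs => rw [← h c (Submodule.mem_span_singleton_self c)]
    simp [TensorProduct.tmul_sum, TensorProduct.smul_tmul]

/-- For a locally projective module `C`, elements of `M ⊗ C` are separated by contractions. -/
theorem IsLocallyProjective.contract_ext (hC : IsLocallyProjective R C) {t t' : M ⊗[R] C}
    (h : ∀ a : C →ₗ[R] R, contract M a t = contract M a t') : t = t' := by
  rw [← sub_eq_zero]
  obtain ⟨F, hF, hF'⟩ := exists_fg_eq_sum_contract (t - t')
  obtain ⟨s, φ, hs⟩ := hC.exists_dual_basis F hF
  rw [hF' s φ hs]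
  exact Finset.sum_eq_zero fun c _ => by rw [map_sub, h, sub_self, TensorProduct.zero_tmul]

theorem exists_fg_contract_eq_zero (t : M ⊗[R] C) :
    ∃ T : Finset C, ∀ a : C →ₗ[R] R, (∀ c ∈ T, a c = 0) → contract M a t = 0 := by
  classical
  induction t with
  | zero => exact ⟨∅, by simp⟩
  | add t₁ t₂ h₁ h₂ =>
    obtain ⟨T₁, h₁⟩ := h₁
    obtain ⟨T₂, h₂⟩ := h₂
    refine ⟨T₁ ∪ T₂, fun a ha => ?_⟩
    rw [map_add, h₁ a fun c hc => ha c (Finset.mem_union_left _ hc),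
      h₂ a fun c hc => ha c (Finset.mem_union_right _ hc), add_zero]
  | tmul m c => exact ⟨{c}, fun a ha => by simp [ha c (Finset.mem_singleton_self c)]⟩

end LocallyProjective

/-! ### Discreteness in terms of annihilators -/

section Discrete

variable {R : Type u} [CommRing R] {C : Type v} [AddCommGroup C] [Module R C]
  {ι : Type*} (D : ι → Submodule R C)

theorem mem_nhds_dualTopology (a : DualAlgebra R C) (U : Set (DualAlgebra R C)) :
    U ∈ @nhds _ (dualTopology D) a ↔
      ∃ S : Finset ι, ∀ b : DualAlgebra R C,
        (∀ α ∈ S, ∀ c ∈ D α, b.ofConv c = a.ofConv c) → b ∈ U := by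
  have h : @nhds _ (dualTopology D) a = ⨅ α, Filter.principal
      {b : DualAlgebra R C | ∀ c ∈ D α, b.ofConv c = a.ofConv c} := by
    rw [nhds_iInf]
    refine iInf_congr fun α => ?_
    let _ : TopologicalSpace (D α →ₗ[R] R) := ⊥
    have : DiscreteTopology (D α →ₗ[R] R) := ⟨rfl⟩
    rw [nhds_induced, nhds_discrete, ← Filter.principal_singleton, Filter.comap_principal]
    congr 1
    ext b
    simp [LinearMap.ext_iff]
  rw [h, Filter.mem_iInf_finite]
  refine exists_congr fun S => ?_
  rw [Filter.iInf_principal_finset, Filter.mem_principal]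
  simp [Set.subset_def]

/-- As `M` is discrete, only continuity of each orbit map `a ↦ a • x` matters, and by additivity it
is enough to check it at `0`. -/
theorem isDiscreteModule_iff [Coalgebra R C] (M : ModuleCat.{w} (DualAlgebra R C)) :
    IsDiscreteModule (dualTopology D) M ↔
      ∀ x : M, ∃ S : Finset ι, ∀ a : DualAlgebra R C,
        (∀ α ∈ S, ∀ c ∈ D α, a.ofConv c = 0) → a • x = 0 := by
  let : TopologicalSpace (DualAlgebra R C) := dualTopology D
  let : TopologicalSpace M := ⊥
  have : DiscreteTopology M := ⟨rfl⟩
  change (Continuous fun p : DualAlgebra R C × M => p.1 • p.2) ↔ _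
  rw [continuous_prod_of_discrete_right]
  refine forall_congr' fun x => ⟨fun h => ?_, fun ⟨S, hS⟩ => ?_⟩
  · have h₁ : {a : DualAlgebra R C | a • x = 0} ∈ nhds (0 : DualAlgebra R C) :=
      ((isOpen_discrete {(0 : M)}).preimage h).mem_nhds (zero_smul (DualAlgebra R C) x)
    obtain ⟨S, hS⟩ := (mem_nhds_dualTopology D _ _).1 h₁
    exact ⟨S, fun a ha => hS a (by simpa using ha)⟩
  · refine continuous_iff_continuousAt.2 fun a => ?_
    rw [ContinuousAt, nhds_discrete M, Filter.tendsto_pure]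
    refine (mem_nhds_dualTopology D _ _).2 ⟨S, fun b hb => ?_⟩
    have h₁ := hS (b - a) fun α hα c hc => by simp [hb α hα c hc]
    rwa [sub_smul, sub_eq_zero] at h₁

theorem RightComodCat.isDiscreteModule_toDualModule [Coalgebra R C]
    (hunion : (⋃ α, (D α : Set C)) = Set.univ) (M : RightComodCat.{u, v, w} R C) :
    IsDiscreteModule (dualTopology D) ((RightComodCat.toDualModule R C).obj M) := by
  classical
  rw [isDiscreteModule_iff]
  intro x
  obtain ⟨T, hT⟩ := exists_fg_contract_eq_zero (M.coact x)
  have h₁ : ∀ c : C, ∃ α, c ∈ D α := fun c => by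
    simpa using (Set.ext_iff.1 hunion c).2 trivial
  choose f hf using h₁
  exact ⟨T.image f, fun a ha => hT a.ofConv fun c hc =>
    ha (f c) (Finset.mem_image_of_mem f hc) c (hf c)⟩

end Discrete

/-! ### From rational modules to comodules -/

section Rational

variable {R : Type u} [CommRing R] {C : Type v} [AddCommGroup C] [Module R C] [Coalgebra R C]

/-- The outer tensor factor meets `b` and the inner one `a`, which is the order in the convolution
`a * b`. -/
theorem contract_contract_comul {M : Type*} [AddCommGroup M] [Module R M]
    (a b : DualAlgebra R C) (t : M ⊗[R] C) :
    contract M a.ofConv (contract (M ⊗[R] C) b.ofConv ((TensorProduct.assoc R M C C).symm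
      ((Coalgebra.comul : C →ₗ[R] C ⊗[R] C).lTensor M t))) = contract M (a * b).ofConv t := by
  have h : ∀ (m : M) (z : C ⊗[R] C), contract M a.ofConv (contract (M ⊗[R] C) b.ofConv
      ((TensorProduct.assoc R M C C).symm (m ⊗ₜ[R] z))) =
        LinearMap.mul' R R (TensorProduct.map a.ofConv b.ofConv z) • m := by
    intro m z
    induction z with
    | zero => simp
    | add z₁ z₂ h₁ h₂ => simp only [TensorProduct.tmul_add, map_add, add_smul, h₁, h₂]
    | tmul c d => simp [smul_smul, mul_comm]
  induction t with
  | zero => simp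
  | add t₁ t₂ h₁ h₂ => simp only [map_add, h₁, h₂]
  | tmul m c =>
    rw [LinearMap.lTensor_tmul, h, contract_tmul]
    rfl

/-- A module over `C^*` is rational if each of its elements `x` has an element `t ∈ M ⊗ C` that
induces the action of `C^*` on `x`. -/
def IsRational (M : Type w) [AddCommGroup M] [Module R M] [Module (DualAlgebra R C) M] : Prop :=
  ∀ x : M, ∃ t : M ⊗[R] C, ∀ a : DualAlgebra R C, contract M a.ofConv t = a • x

theorem isRational_of_annihilator (hC : IsLocallyProjective R C)
    {M : Type w} [AddCommGroup M] [Module R M] [Module (DualAlgebra R C) M]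
    [IsScalarTower R (DualAlgebra R C) M]
    (hM : ∀ x : M, ∃ F : Submodule R C, F.FG ∧ ∀ a : DualAlgebra R C,
      (∀ c ∈ F, a.ofConv c = 0) → a • x = 0) :
    IsRational (R := R) (C := C) M := by
  intro x
  obtain ⟨F, hF, hx⟩ := hM x
  obtain ⟨s, φ, hs⟩ := hC.exists_dual_basis F hF
  refine ⟨∑ c ∈ s, ((WithConv.toConv (φ c) : DualAlgebra R C) • x) ⊗ₜ[R] c, fun a => ?_⟩
  -- By the dual basis property `∑ a(c) φ c` and `a` agree on `F`.
  have h₁ : ((∑ c ∈ s, a.ofConv c • (WithConv.toConv (φ c) : DualAlgebra R C)) - a) • x = 0 := by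
    refine hx _ fun y hy => ?_
    have h₂ := congrArg a.ofConv (hs y hy)
    simp only [map_sum, map_smul, smul_eq_mul] at h₂
    simp [← h₂, mul_comm]
  rw [sub_smul, sub_eq_zero, Finset.sum_smul] at h₁
  simp only [map_sum, contract_tmul, ← h₁, smul_assoc]

namespace IsRational

variable {M : Type w} [AddCommGroup M] [Module R M] [Module (DualAlgebra R C) M]
  [IsScalarTower R (DualAlgebra R C) M]

theorem dual_smul_comm (r : R) (a : DualAlgebra R C) (x : M) : a • r • x = r • a • x := by
  rw [← algebraMap_smul (DualAlgebra R C) r x, ← algebraMap_smul (DualAlgebra R C) r (a • x),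
    ← mul_smul, ← mul_smul, Algebra.commutes]

variable (hC : IsLocallyProjective R C) (hM : IsRational (R := R) (C := C) M)

/-- The coaction on a rational module over `C^*`. -/
noncomputable def coact : M →ₗ[R] M ⊗[R] C where
  toFun x := (hM x).choose
  map_add' x y := hC.contract_ext fun a => by
    have h := fun z => (hM z).choose_spec (WithConv.toConv a)
    simp only at h
    rw [map_add, h, h, h, smul_add]
  map_smul' r x := hC.contract_ext fun a => by
    have h := fun z => (hM z).choose_spec (WithConv.toConv a)
    simp only at h
    rw [RingHom.id_apply, map_smul, h, h, dual_smul_comm]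

theorem contract_coact (a : DualAlgebra R C) (x : M) :
    contract M a.ofConv (coact hC hM x) = a • x :=
  (hM x).choose_spec a

/-- The comodule structure on a rational module over `C^*`. -/
noncomputable abbrev comod : RightComodCat.{u, v, w} R C where
  carrier := M
  coact := coact hC hM
  coassoc := by
    refine LinearMap.ext fun x => ?_
    -- In `(M ⊗ C) ⊗ C` separation by contractions applies twice; both sides then contract to `(a *
    -- b) • x`.
    refine ((TensorProduct.assoc R M C C).eq_symm_apply).1 ?_
    refine hC.contract_ext fun b => hC.contract_ext fun a => ?_
    have h := contract_contract_comul (WithConv.toConv a) (WithConv.toConv b) (coact hC hM x)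
    refine Eq.trans ?_ h.symm
    rw [contract_coact, mul_smul, LinearMap.comp_apply, contract_rTensor]
    refine (contract_coact hC hM (WithConv.toConv a) _).trans ?_
    exact congrArg _ (contract_coact hC hM (WithConv.toConv b) x)
  counit := LinearMap.ext fun x => (contract_coact hC hM 1 x).trans (one_smul _ x)

end IsRational

end Rational

/-! ### The inverse functor and equality of functors -/

section Functor

variable {R : Type u} [CommRing R] {C : Type v} [AddCommGroup C] [Module R C] [Coalgebra R C]

namespace RightComodCat

theorem smul_eq_act (M : RightComodCat.{u, v, w} R C) (r : R) (x : M.carrier) :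
    r • x = M.act (algebraMap R (DualAlgebra R C) r) x := by
  have h : (algebraMap R (DualAlgebra R C) r) = r • (1 : DualAlgebra R C) :=
    Algebra.algebraMap_eq_smul_one r
  have h₁ : M.act 1 x = x := LinearMap.congr_fun M.counit x
  rw [h]
  nth_rw 1 [← h₁]
  simp [act, LinearMap.lTensor_smul]

/-- A comodule over a locally projective coalgebra is determined by the action of `C^*`. -/
theorem mk_eq_of_act_eq (hC : IsLocallyProjective R C) (X : Type w) [AddCommGroup X]
    (m₁ m₂ : Module R X) (ρ₁ ρ₂ h₁ h₂ k₁ k₂)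
    (h : ∀ (a : DualAlgebra R C) (x : X),
      (@RightComodCat.mk R _ C _ _ _ X _ m₁ ρ₁ h₁ k₁).act a x =
        (@RightComodCat.mk R _ C _ _ _ X _ m₂ ρ₂ h₂ k₂).act a x) :
    @RightComodCat.mk R _ C _ _ _ X _ m₁ ρ₁ h₁ k₁ =
      @RightComodCat.mk R _ C _ _ _ X _ m₂ ρ₂ h₂ k₂ := by
  -- The types of `ρ₁` and `ρ₂` depend on the `R`-structures, so these are identified first: `r`
  -- acts as the image of `r` in `C^*`.
  have hm : m₁ = m₂ := by
    refine Module.ext' _ _ fun r x => ?_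
    exact (smul_eq_act (@RightComodCat.mk R _ C _ _ _ X _ m₁ ρ₁ h₁ k₁) r x).trans
      ((h _ x).trans (smul_eq_act (@RightComodCat.mk R _ C _ _ _ X _ m₂ ρ₂ h₂ k₂) r x).symm)
  subst hm
  have hρ : ρ₁ = ρ₂ :=
    LinearMap.ext fun x => hC.contract_ext fun a => h (WithConv.toConv a) x
  subst hρ
  rfl

/-- Equality of functors compares morphisms between objects that are only propositionally equal;
this reduces it to the underlying functions. -/
theorem hom_heq {M₁ M₂ N₁ N₂ : RightComodCat.{u, v, w} R C} (hM : M₁ = M₂) (hN : N₁ = N₂)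
    (f : M₁ ⟶ N₁) (g : M₂ ⟶ N₂) (h : HEq (⇑f.toLinearMap) (⇑g.toLinearMap)) : HEq f g := by
  subst hM hN
  exact heq_of_eq (Hom.ext (DFunLike.coe_injective (eq_of_heq h)))

end RightComodCat

theorem ModuleCat.of_eq_of_smul_eq {A : Type u} [Ring A] (X : ModuleCat.{w} A) (m : Module A X)
    (h : ∀ (a : A) (x : X), m.smul a x = X.isModule.smul a x) : @ModuleCat.of A _ X _ m = X := by
  have hm : m = X.isModule := Module.ext' _ _ h
  subst hm
  rfl

theorem CategoryTheory.ObjectProperty.FullSubcategory.moduleCat_hom_heq {A : Type u} [Ring A]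
    {P : ObjectProperty (ModuleCat.{w} A)} {M₁ M₂ N₁ N₂ : P.FullSubcategory}
    (hM : M₁ = M₂) (hN : N₁ = N₂) (f : M₁ ⟶ N₁) (g : M₂ ⟶ N₂)
    (h : HEq (⇑f.hom.hom) (⇑g.hom.hom)) : HEq f g := by
  subst hM hN
  exact heq_of_eq (ObjectProperty.hom_ext _
    (ModuleCat.hom_ext (DFunLike.coe_injective (eq_of_heq h))))

/-- The `R`-module underlying a `C^*`-module. -/
noncomputable abbrev baseModule (M : ModuleCat.{w} (DualAlgebra R C)) : Module R M :=
  Module.compHom M (algebraMap R (DualAlgebra R C))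

attribute [local instance] baseModule

theorem isScalarTower_baseModule (M : ModuleCat.{w} (DualAlgebra R C)) :
    IsScalarTower R (DualAlgebra R C) M :=
  ⟨fun r a x => by
    rw [Algebra.smul_def, mul_smul]
    rfl⟩

attribute [local instance] isScalarTower_baseModule

variable {ι : Type*} {D : ι → Submodule R C}

theorem isRational_of_isDiscreteModule (hC : IsLocallyProjective R C)
    (hfin : ∀ α, Module.Finite R (D α)) (M : ModuleCat.{w} (DualAlgebra R C))
    (hM : IsDiscreteModule (dualTopology D) M) : IsRational (R := R) (C := C) M := by
  refine isRational_of_annihilator hC fun x => ?_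
  obtain ⟨S, hS⟩ := (isDiscreteModule_iff D M).1 hM x
  refine ⟨⨆ α ∈ S, D α, Submodule.fg_biSup S D fun α _ => Module.Finite.iff_fg.1 (hfin α),
    fun a ha => hS a fun α hα c hc => ha c ?_⟩
  exact (le_iSup₂_of_le α hα le_rfl : D α ≤ ⨆ α ∈ S, D α) hc

/-- The functor from discrete `C^*`-modules to comodules, the identity on underlying abelian
groups and on underlying maps. -/
noncomputable def discreteToComod (hC : IsLocallyProjective R C)
    (hfin : ∀ α, Module.Finite R (D α)) :
    DiscModuleCat.{max u v, w} (DualAlgebra R C) (dualTopology D) ⥤ RightComodCat.{u, v, w} R C where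
  obj X := (isRational_of_isDiscreteModule hC hfin X.obj X.property).comod hC
  map {X Y} f :=
    { toLinearMap :=
        { toFun := f.hom.hom
          map_add' := map_add f.hom.hom
          map_smul' := fun r x => map_smul f.hom.hom (algebraMap R (DualAlgebra R C) r) x }
      comm := LinearMap.ext fun x => hC.contract_ext fun a => by
        refine (IsRational.contract_coact hC _ (WithConv.toConv a) (f.hom.hom x)).trans ?_
        refine (map_smul f.hom.hom (WithConv.toConv a) x).symm.trans ?_
        rw [LinearMap.comp_apply, contract_rTensor]
        exact congrArg f.hom.hom (IsRational.contract_coact hC _ (WithConv.toConv a) x).symm }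
  map_id _ := rfl
  map_comp _ _ := rfl

theorem discreteToComod_obj_act (hC : IsLocallyProjective R C)
    (hfin : ∀ α, Module.Finite R (D α))
    (X : DiscModuleCat.{max u v, w} (DualAlgebra R C) (dualTopology D))
    (a : DualAlgebra R C) (x : X.obj) :
    ((discreteToComod hC hfin).obj X).act a x = a • x :=
  IsRational.contract_coact hC _ a x

end Functor

theorem mainTheorem5 (R : Type u) [CommRing R] [IsNoetherianRing R]
    (C : Type v) [AddCommGroup C] [Module R C] [Coalgebra R C]
    (hC : IsLocallyProjective R C)
    {ι : Type*} (D : ι → Submodule R C)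
    (hsub : ∀ α, IsSubcoalgebra (D α))
    (hfin : ∀ α, Module.Finite R (D α))
    (hproj : ∀ α, Module.Projective R (D α))
    (hunion : (⋃ α, (D α : Set C)) = Set.univ) :
    ∃ hdisc : ∀ M : RightComodCat.{u, v, w} R C,
        IsDiscreteModule (dualTopology D) ((RightComodCat.toDualModule R C).obj M),
      ∃ G : DiscModuleCat.{max u v, w} (DualAlgebra R C) (dualTopology D) ⥤
          RightComodCat.{u, v, w} R C,
        (IsDiscreteModule (dualTopology D)).lift (RightComodCat.toDualModule R C) hdisc ⋙ G =
            𝟭 (RightComodCat.{u, v, w} R C) ∧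
        G ⋙ (IsDiscreteModule (dualTopology D)).lift (RightComodCat.toDualModule R C) hdisc =
            𝟭 (DiscModuleCat.{max u v, w} (DualAlgebra R C) (dualTopology D)) := by
  have hdisc := RightComodCat.isDiscreteModule_toDualModule D hunion
  have h₁ : ∀ M : RightComodCat.{u, v, w} R C, (discreteToComod hC hfin).obj
      (((IsDiscreteModule (dualTopology D)).lift (RightComodCat.toDualModule R C) hdisc).obj M) =
        M := fun M =>
    RightComodCat.mk_eq_of_act_eq hC M.carrier _ _ _ _ _ _ _ _ fun a x =>
      discreteToComod_obj_act hC hfin ⟨_, hdisc M⟩ a x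
  have h₂ : ∀ X : DiscModuleCat.{max u v, w} (DualAlgebra R C) (dualTopology D),
      ((IsDiscreteModule (dualTopology D)).lift (RightComodCat.toDualModule R C) hdisc).obj
        ((discreteToComod hC hfin).obj X) = X := fun X =>
    ObjectProperty.FullSubcategory.ext
      (ModuleCat.of_eq_of_smul_eq X.obj _ fun a x => discreteToComod_obj_act hC hfin X a x)
  exact ⟨hdisc, discreteToComod hC hfin,
    -- Both functors leave the underlying functions unchanged by definition, so `HEq.rfl` suffices.
    Functor.hext h₁ fun M N f => RightComodCat.hom_heq (h₁ M) (h₁ N) _ _ HEq.rfl,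
    Functor.hext h₂ fun X Y f =>
      ObjectProperty.FullSubcategory.moduleCat_hom_heq (h₂ X) (h₂ Y) _ _ HEq.rfl⟩
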